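/- Let $\mathcal{L} = \{+, -, 0, <, \rho\cdot, \rho^{-1}\cdot\}$ be the language of ordered groups with two additional unary function symbols $\rho\cdot$ and $\rho^{-1}\cdot$. For $L = \sum_{i=0}^{k} m_i\rho^i \in \mathbb{Z}[\rho]$ (a polynomial in the formal variable $\rho$) write $L\cdot x := \sum_{i=0}^{k} m_i(\rho^i\cdot x)$, where $\rho^i\cdot x$ is the result of applying $\rho\cdot$ to $x$ exactly $i$ times; such an $L$ is called a linear difference operator. Let $MODAG$ be the $\mathcal{L}$-theory of multiplicative ordered difference abelian groups, which is axiomatized by: the axioms of abelian groups; the axioms of strict linear orders; $x<y \Rightarrow x+z<y+z$, $x<y\Rightarrow \rho\cdot x<\rho\cdot y$ and $x<y\Rightarrow\rho^{-1}\cdot x<\rho^{-1}\cdot y$; $\rho\cdot$ and $\rho^{-1}\cdot$ are group endomorphisms inverse to each other; and, for each $L\in\mathbb{Z}[\rho]$, Axiom OM: $$\Big(\forall x>0\,(L\cdot x>0)\Big)\vee\Big(\forall x>0\,(L\cdot x=0)\Big)\vee\Big(\forall x>0\,(L\cdot x<0)\Big).$$ Let $MODDAG$ be the $\mathcal{L}$-theory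 of nontrivial multiplicative ordered divisible difference abelian groups, which is axiomatized by $MODAG$ together with $\exists x\,(x\neq 0)$ and, for each $L\in\mathbb{Z}[\rho]$, the axiom $$\Big(\forall x\,(L\cdot x=0)\Big)\vee\Big(\forall x\,\exists y\,(L\cdot y=x)\Big).$$ Theorem. $MODDAG$ is the model companion of $MODAG$. That is, every model of $MODAG$ embeds into a model of $MODDAG$, every model of $MODDAG$ embeds into a model of $MODAG$, and $MODDAG$ is model complete: every embedding between models of $MODDAG$ is elementary. -/

import Mathlib

namespace FirstOrder.Language

/-- A theory is model complete if every embedding between two of its models is elementary. -/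
def Theory.IsModelComplete.{u, v, w} {L : Language.{u, v}} (T : L.Theory) : Prop :=
  ∀ (M N : Type w) [L.Structure M] [L.Structure N] [Nonempty M] [Nonempty N] [M ⊨ T] [N ⊨ T]
    (f : M ↪[L] N) (n : ℕ) (φ : L.Formula (Fin n)) (x : Fin n → M),
    φ.Realize (f ∘ x) ↔ φ.Realize x

/-- Every model of `T` embeds into a model of `T'`. -/
def Theory.ModelsEmbedInto.{u, v, w} {L : Language.{u, v}} (T T' : L.Theory) : Prop :=
  ∀ (M : Type w) [L.Structure M] [Nonempty M] [M ⊨ T],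
    ∃ (N : Type w) (_ : L.Structure N) (_ : Nonempty N) (_ : N ⊨ T'), Nonempty (M ↪[L] N)

/-- `T'` is a model companion of `T`: the two theories are co-theories (every model of either one
embeds into a model of the other one), and `T'` is model complete. -/
structure Theory.IsModelCompanion.{u, v, w} {L : Language.{u, v}} (T' T : L.Theory) : Prop where
  embeds : Theory.ModelsEmbedInto.{u, v, w} T T'
  embeds' : Theory.ModelsEmbedInto.{u, v, w} T' T
  modelComplete : Theory.IsModelComplete.{u, v, w} T'

end FirstOrder.Language

namespace OrderedDifferenceGroup

open FirstOrder FirstOrder.Language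

/-- The function symbols `0`, `-` (unary), `ρ·`, `ρ⁻¹·` and `+`. -/
inductive Func : ℕ → Type
  | zero : Func 0
  | neg : Func 1
  | rho : Func 1
  | rhoInv : Func 1
  | add : Func 2

/-- The relation symbol `<`. -/
inductive Rel : ℕ → Type
  | lt : Rel 2

/-- The language `{+, -, 0, <, ρ·, ρ⁻¹·}` of ordered difference groups. -/
def lang : Language := ⟨Func, Rel⟩

section Terms

variable {α : Type}

def zeroT : lang.Term α := Constants.term (L := lang) Func.zero

def negT (t : lang.Term α) : lang.Term α := Functions.apply₁ (L := lang) Func.neg t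

def rhoT (t : lang.Term α) : lang.Term α := Functions.apply₁ (L := lang) Func.rho t

def rhoInvT (t : lang.Term α) : lang.Term α := Functions.apply₁ (L := lang) Func.rhoInv t

def addT (s t : lang.Term α) : lang.Term α := Functions.apply₂ (L := lang) Func.add s t

/-- The atomic formula `s < t`. -/
def ltF {n : ℕ} (s t : lang.Term (α ⊕ Fin n)) : lang.BoundedFormula α n :=
  Relations.boundedFormula₂ (L := lang) Rel.lt s t

/-- The term `m t = t + ⋯ + t` for a natural number `m`. -/
def natMulT : ℕ → lang.Term α → lang.Term α
  | 0, _ => zeroT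
  | m + 1, t => addT (natMulT m t) t

/-- The term `m t` for an integer `m`, with `(-m) t = -(m t)`. -/
def intMulT : ℤ → lang.Term α → lang.Term α
  | Int.ofNat m, t => natMulT m t
  | Int.negSucc m, t => negT (natMulT (m + 1) t)

/-- The term `ρ · ρ ⋯ ρ · t` with `i` occurrences of `ρ`. -/
def rhoPowT : ℕ → lang.Term α → lang.Term α
  | 0, t => t
  | i + 1, t => rhoT (rhoPowT i t)

/-- The partial sum of the terms `mᵢ (ρⁱ · t)` over `i < k`, where `mᵢ` is the `i`-th coefficient
of `p`. -/
noncomputable def partialOpT (p : Polynomial ℤ) (t : lang.Term α) : ℕ → lang.Term α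
  | 0 => zeroT
  | k + 1 => addT (partialOpT p t k) (intMulT (p.coeff k) (rhoPowT k t))

/-- The term `p · t`: the linear difference operator given by the integer polynomial
`p = ∑ mᵢ ρⁱ`, applied to `t`. -/
noncomputable def opT (p : Polynomial ℤ) (t : lang.Term α) : lang.Term α :=
  partialOpT p t (p.natDegree + 1)

end Terms

/-- The axioms of abelian groups. -/
def abelianGroupAxioms : lang.Theory :=
  { ∀' ∀' ∀' (addT (addT (&0) (&1)) (&2) =' addT (&0) (addT (&1) (&2))),
    ∀' ∀' (addT (&0) (&1) =' addT (&1) (&0)),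
    ∀' (addT (&0) zeroT =' &0),
    ∀' (addT (&0) (negT (&0)) =' zeroT) }

/-- The axioms of (strict) linear orders. -/
def linearOrderAxioms : lang.Theory :=
  { ∀' ∼(ltF (&0) (&0)),
    ∀' ∀' ∀' (ltF (&0) (&1) ⟹ ltF (&1) (&2) ⟹ ltF (&0) (&2)),
    ∀' ∀' (ltF (&0) (&1) ⊔ (&0 =' &1) ⊔ ltF (&1) (&0)) }

/-- Compatibility of the order with `+`, `ρ·` and `ρ⁻¹·`. -/
def orderCompatibilityAxioms : lang.Theory :=
  { ∀' ∀' ∀' (ltF (&0) (&1) ⟹ ltF (addT (&0) (&2)) (addT (&1) (&2))),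
    ∀' ∀' (ltF (&0) (&1) ⟹ ltF (rhoT (&0)) (rhoT (&1))),
    ∀' ∀' (ltF (&0) (&1) ⟹ ltF (rhoInvT (&0)) (rhoInvT (&1))) }

/-- `ρ·` and `ρ⁻¹·` are endomorphisms of the group, inverse to each other. -/
def automorphismAxioms : lang.Theory :=
  { ∀' ∀' (rhoT (addT (&0) (&1)) =' addT (rhoT (&0)) (rhoT (&1))),
    ∀' ∀' (rhoInvT (addT (&0) (&1)) =' addT (rhoInvT (&0)) (rhoInvT (&1))),
    ∀' (rhoT (rhoInvT (&0)) =' &0),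
    ∀' (rhoInvT (rhoT (&0)) =' &0) }

/-- The theory of ordered difference abelian groups. -/
def orderedDifferenceAbelianGroups : lang.Theory :=
  abelianGroupAxioms ∪ linearOrderAxioms ∪ orderCompatibilityAxioms ∪ automorphismAxioms

/-- The instance of Axiom OM for the linear difference operator `p`:
`(∀ x > 0, p · x > 0) ∨ (∀ x > 0, p · x = 0) ∨ (∀ x > 0, p · x < 0)`. -/
noncomputable def axiomOM (p : Polynomial ℤ) : lang.Sentence :=
  (∀' (ltF zeroT (&0) ⟹ ltF zeroT (opT p (&0)))) ⊔
    (∀' (ltF zeroT (&0) ⟹ (opT p (&0) =' zeroT))) ⊔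
    (∀' (ltF zeroT (&0) ⟹ ltF (opT p (&0)) zeroT))

/-- The theory of multiplicative ordered difference abelian groups. -/
def MODAG : lang.Theory :=
  orderedDifferenceAbelianGroups ∪ Set.range axiomOM

/-- The sentence `∃ x, x ≠ 0`. -/
def nontrivialAxiom : lang.Sentence := ∃' ∼(&0 =' zeroT)

/-- The linear difference operator `p` is zero or surjective:
`(∀ x, p · x = 0) ∨ (∀ x, ∃ y, p · y = x)`. -/
noncomputable def divisibilityAxiom (p : Polynomial ℤ) : lang.Sentence :=
  (∀' (opT p (&0) =' zeroT)) ⊔ (∀' ∃' (opT p (&1) =' &0))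

/-- The theory of nontrivial multiplicative ordered divisible difference abelian groups. -/
def MODDAG : lang.Theory :=
  MODAG ∪ {nontrivialAxiom} ∪ Set.range divisibilityAxiom

end OrderedDifferenceGroup

universe w

/-! Axiom OM says that each linear difference operator acts with a single sign. A model of `MODAG`
is therefore an ordered `ℤ[X]`-module with a map `σ : ℤ[X] → SignType` such that `sign (p • x) = σ p
* sign x` (`exists_actsWithSign`). `MODDAG` asks in addition that the module be nontrivial and that
every `p` with `σ p ≠ 0` be onto.

Embedding into `MODDAG`: the operators of positive sign form a multiplicative set acting
injectively. Localizing at it makes them invertible, and a fraction takes the sign of its numerator,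
so the order and `σ` extend (`exists_signDivisible_extension`). The trivial group embeds in `ℚ` with
`ρ = 1`. Conversely, a model of `MODDAG` is already a model of `MODAG`.

Model completeness: for a fixed `σ`, quantifiers are eliminated as for ordered vector spaces. Up to
powers of `ρ`, terms are linear forms, so atomic formulas are sign conditions on such forms. A form
in which the last variable has a coefficient of nonzero sign changes sign only at its root, which
exists by divisibility. The order of the roots is again given by signs of forms in the other
variables, and density realizes every cut among them (`exists_extend_sameSigns`). By induction, the
truth of a formula depends on the signs of finitely many forms (`exists_finite_sameSigns`). An
embedding forces both models to have the same `σ` and preserves these signs. -/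

namespace OrderedDifferenceGroup

open FirstOrder FirstOrder.Language Polynomial SignType

/-- Every scalar `p` acts on the ordered module `V` by preserving, annihilating or reversing signs,
according to `σ p`. -/
def ActsWithSign {A : Type*} [Ring A] (σ : A → SignType) (V : Type*) [AddCommGroup V]
    [LinearOrder V] [Module A V] : Prop :=
  ∀ (p : A) (x : V), sign (p • x) = σ p * sign x

/-- Every scalar of nonzero sign acts surjectively. -/
def IsSignDivisible {A : Type*} [Ring A] (σ : A → SignType) (V : Type*) [AddCommGroup V]
    [Module A V] : Prop :=
  ∀ p : A, σ p ≠ 0 → Function.Surjective fun x : V => p • x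

/-! ### Arithmetic of signs of scalars -/

section Sign

variable {A : Type*} [CommRing A] {σ : A → SignType}
  {V : Type*} [AddCommGroup V] [LinearOrder V] [Module A V]

theorem ActsWithSign.eq_sign_smul (hσ : ActsWithSign σ V) {x : V} (hx : 0 < x) (p : A) :
    σ p = sign (p • x) := by
  rw [hσ, sign_pos hx, mul_one]

theorem exists_pos_of_nontrivial (V : Type*) [AddCommGroup V] [LinearOrder V]
    [IsOrderedAddMonoid V] [Nontrivial V] : ∃ x : V, 0 < x := by
  obtain ⟨x, hx⟩ := exists_ne (0 : V)
  exact ⟨|x|, abs_pos.2 hx⟩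

variable [IsOrderedAddMonoid V] [Nontrivial V]

theorem ActsWithSign.map_one (hσ : ActsWithSign σ V) : σ 1 = 1 := by
  obtain ⟨x, hx⟩ := exists_pos_of_nontrivial V
  rw [hσ.eq_sign_smul hx, one_smul, sign_pos hx]

theorem ActsWithSign.map_mul (hσ : ActsWithSign σ V) (p q : A) : σ (p * q) = σ p * σ q := by
  obtain ⟨x, hx⟩ := exists_pos_of_nontrivial V
  rw [hσ.eq_sign_smul hx, mul_smul, hσ, ← hσ.eq_sign_smul hx]

theorem ActsWithSign.map_neg (hσ : ActsWithSign σ V) (p : A) : σ (-p) = -σ p := by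
  obtain ⟨x, hx⟩ := exists_pos_of_nontrivial V
  rw [hσ.eq_sign_smul hx, neg_smul, Left.sign_neg, ← hσ.eq_sign_smul hx]

theorem ActsWithSign.map_two (hσ : ActsWithSign σ V) : σ 2 = 1 := by
  obtain ⟨x, hx⟩ := exists_pos_of_nontrivial V
  rw [hσ.eq_sign_smul hx, two_smul, sign_pos (add_pos hx hx)]

/-- The scalar 2 has sign 1, so midpoints exist. -/
theorem ActsWithSign.denselyOrdered (hσ : ActsWithSign σ V) (hd : IsSignDivisible σ V) :
    DenselyOrdered V := by
  refine ⟨fun a b hab => ?_⟩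
  obtain ⟨y, hy⟩ := hd 2 (by rw [hσ.map_two]; decide) (a + b)
  simp only [two_smul] at hy
  refine ⟨y, ?_, ?_⟩
  · by_contra! h
    exact absurd hy (add_le_add h h |>.trans_lt (add_lt_add_right hab a)).ne
  · by_contra! h
    exact absurd hy ((add_lt_add_left hab b).trans_le (add_le_add h h)).ne'

end Sign

/-! ### Eliminating one variable from sign conditions -/

section BackAndForth

/-- The hypothesis says that `t i ↦ u i` preserves order and equality. The cut of `a` among the `t
i` thus transfers to the `u i`, and a dense order without endpoints fills it. -/
theorem exists_sign_sub_eq {ι V W : Type*} [AddCommGroup V] [LinearOrder V] [IsOrderedAddMonoid V]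
    [AddCommGroup W] [LinearOrder W] [IsOrderedAddMonoid W] [Nontrivial W] [DenselyOrdered W]
    (I : Finset ι) (t : ι → V) (u : ι → W)
    (h : ∀ i ∈ I, ∀ j ∈ I, sign (t i - t j) = sign (u i - u j)) (a : V) :
    ∃ b : W, ∀ i ∈ I, sign (a - t i) = sign (b - u i) := by
  classical
  by_cases ha : ∃ i ∈ I, t i = a
  · obtain ⟨i, hi, rfl⟩ := ha
    exact ⟨u i, fun j hj => h i hi j hj⟩
  · push Not at ha
    obtain ⟨b, hb, hb'⟩ := Order.exists_between_finsets
      ((I.filter fun i => t i < a).image u) ((I.filter fun i => a < t i).image u) (by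
        simp only [Finset.mem_image, Finset.mem_filter]
        rintro _ ⟨i, ⟨hi, hia⟩, rfl⟩ _ ⟨j, ⟨hj, hja⟩, rfl⟩
        have := h j hj i hi
        rw [sign_pos (sub_pos.2 (hia.trans hja))] at this
        exact sub_pos.1 (sign_eq_one_iff.1 this.symm))
    refine ⟨b, fun i hi => ?_⟩
    rcases lt_or_gt_of_ne (ha i hi) with h' | h'
    · rw [sign_pos (sub_pos.2 h'), sign_pos (sub_pos.2 (hb _ (Finset.mem_image_of_mem _
        (Finset.mem_filter.2 ⟨hi, h'⟩))))]
    · rw [sign_neg (sub_neg.2 h'), sign_neg (sub_neg.2 (hb' _ (Finset.mem_image_of_mem _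
        (Finset.mem_filter.2 ⟨hi, h'⟩))))]

variable {A : Type*} [CommRing A] {ι : Type*}

/-- The tuples `x` and `y` give the same sign to every linear form in `S`. -/
def SameSigns [Fintype ι] {V W : Type*} [AddCommGroup V] [LinearOrder V] [Module A V]
    [AddCommGroup W] [LinearOrder W] [Module A W]
    (S : Set (ι → A)) (x : ι → V) (y : ι → W) : Prop :=
  ∀ c ∈ S, sign (∑ i, c i • x i) = sign (∑ i, c i • y i)

/-- The linear forms obtained from `S` by eliminating the last variable. -/
def eliminate (S : Set ((ι → A) × A)) : Set (ι → A) :=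
  Prod.fst '' S ∪
    (fun q : ((ι → A) × A) × ((ι → A) × A) => q.1.2 • q.2.1 - q.2.2 • q.1.1) '' (S ×ˢ S)

theorem eliminate_finite {S : Set ((ι → A) × A)} (hS : S.Finite) : (eliminate S).Finite :=
  (hS.image _).union ((hS.prod hS).image _)

/-- Clearing denominators turns the comparison of two roots into the sign of a form without the last
variable; these are the cross terms of `eliminate`. -/
theorem sign_root_sub_root [Fintype ι] {σ : A → SignType} {V : Type*} [AddCommGroup V]
    [LinearOrder V] [IsOrderedAddMonoid V] [Module A V] (hσ : ActsWithSign σ V)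
    {x : ι → V} {c d : ι → A} {p q : A} {s t : V}
    (hs : p • s = -∑ i, c i • x i) (ht : q • t = -∑ i, d i • x i) :
    σ p * (σ q * sign (s - t)) = sign (∑ i, (p • d - q • c) i • x i) := by
  rw [← hσ, ← hσ, smul_sub, smul_sub, smul_comm p q s, hs, ht]
  congr 1
  simp only [Pi.sub_apply, Pi.smul_apply, smul_eq_mul, sub_smul, mul_smul, Finset.sum_sub_distrib,
    ← Finset.smul_sum]
  simp only [smul_neg]
  abel

theorem exists_extend_sameSigns [Fintype ι] {σ : A → SignType} {V W : Type*}
    [AddCommGroup V] [LinearOrder V] [IsOrderedAddMonoid V] [Module A V]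
    [AddCommGroup W] [LinearOrder W] [IsOrderedAddMonoid W] [Module A W] [Nontrivial W]
    (hV : ActsWithSign σ V) (hW : ActsWithSign σ W)
    (hdV : IsSignDivisible σ V) (hdW : IsSignDivisible σ W)
    {S : Set ((ι → A) × A)} (hS : S.Finite) {x : ι → V} {y : ι → W}
    (hxy : SameSigns (eliminate S) x y) (a : V) :
    ∃ b : W, ∀ p ∈ S, sign (∑ i, p.1 i • x i + p.2 • a) = sign (∑ i, p.1 i • y i + p.2 • b) := by
  classical
  have := hW.denselyOrdered hdW
  have hroot : ∀ p : (ι → A) × A, ∃ (s : V) (t : W), σ p.2 ≠ 0 →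
      p.2 • s = -∑ i, p.1 i • x i ∧ p.2 • t = -∑ i, p.1 i • y i := by
    intro p
    by_cases hp : σ p.2 = 0
    · exact ⟨0, 0, fun h => absurd hp h⟩
    · obtain ⟨s, hs⟩ := hdV p.2 hp (-∑ i, p.1 i • x i)
      obtain ⟨t, ht⟩ := hdW p.2 hp (-∑ i, p.1 i • y i)
      exact ⟨s, t, fun _ => ⟨hs, ht⟩⟩
  choose s t hst using hroot
  obtain ⟨b, hb⟩ := exists_sign_sub_eq (hS.toFinset.filter fun p => σ p.2 ≠ 0) s t (by
    intro p hp q hq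
    simp only [Finset.mem_filter, Set.Finite.mem_toFinset] at hp hq
    have h1 := sign_root_sub_root hV (hst p hp.2).1 (hst q hq.2).1
    have h2 := sign_root_sub_root hW (hst p hp.2).2 (hst q hq.2).2
    rw [hxy _ (Or.inr ⟨(p, q), ⟨hp.1, hq.1⟩, rfl⟩), ← h2] at h1
    -- Nonzero signs cancel, so the sign of the cross term determines the sign of the difference of
    -- the roots.
    exact mul_left_cancel₀ hq.2 (mul_left_cancel₀ hp.2 h1)) a
  refine ⟨b, fun p hp => ?_⟩
  -- A coefficient of sign zero kills the last variable, and the rest of the form belongs to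
  -- `eliminate S`. Otherwise the form is `p.2` applied to the distance from its root.
  by_cases h0 : σ p.2 = 0
  · have h1 : p.2 • a = 0 := by rw [← sign_eq_zero_iff, hV, h0, zero_mul]
    have h2 : p.2 • b = 0 := by rw [← sign_eq_zero_iff, hW, h0, zero_mul]
    rw [h1, h2, add_zero, add_zero]
    exact hxy _ (Or.inl ⟨p, hp, rfl⟩)
  · have h1 : ∑ i, p.1 i • x i + p.2 • a = p.2 • (a - s p) := by
      rw [smul_sub, (hst p h0).1]; abel
    have h2 : ∑ i, p.1 i • y i + p.2 • b = p.2 • (b - t p) := by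
      rw [smul_sub, (hst p h0).2]; abel
    rw [h1, h2, hV, hW, hb p (by simp [hp, h0])]

end BackAndForth

/-! ### Making scalars invertible by localization -/

section Localization

variable {A : Type*} [CommRing A] {σ : A → SignType}
  {V : Type*} [AddCommGroup V] [LinearOrder V] [IsOrderedAddMonoid V] [Module A V] [Nontrivial V]

/-- The scalars acting by preserving signs. -/
def positiveScalars (hσ : ActsWithSign σ V) : Submonoid A where
  carrier := {p | σ p = 1}
  one_mem' := hσ.map_one
  mul_mem' {p q} hp hq := by
    simp only [Set.mem_ofPred_eq] at hp hq ⊢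
    rw [hσ.map_mul, hp, hq, mul_one]

theorem sign_positiveScalars_smul (hσ : ActsWithSign σ V) (s : positiveScalars hσ) (x : V) :
    sign (s • x) = sign x := by
  have hs : σ (s : A) = 1 := s.2
  rw [Submonoid.smul_def, hσ, hs, one_mul]

/-- The sign of a fraction with a positive denominator. -/
def localizedSign (hσ : ActsWithSign σ V) (z : LocalizedModule (positiveScalars hσ) V) : SignType :=
  z.liftOn (fun q => sign q.1) (by
    rintro ⟨m, s⟩ ⟨m', s'⟩ ⟨u, hu⟩
    simpa only [sign_positiveScalars_smul] using congrArg sign hu)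

@[simp]
theorem localizedSign_mk (hσ : ActsWithSign σ V) (m : V) (s : positiveScalars hσ) :
    localizedSign hσ (LocalizedModule.mk m s) = sign m :=
  LocalizedModule.liftOn_mk _ m s

/-- The nonnegative fractions. -/
def localizedCone (hσ : ActsWithSign σ V) :
    AddGroupCone (LocalizedModule (positiveScalars hσ) V) where
  carrier := {z | 0 ≤ localizedSign hσ z}
  zero_mem' := by
    rw [Set.mem_ofPred_eq, ← LocalizedModule.zero_mk 1, localizedSign_mk, sign_zero]
  add_mem' {a b} := by
    induction a, b using LocalizedModule.induction_on₂ with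
    | h m m' s s' =>
      simp only [Set.mem_ofPred_eq, LocalizedModule.mk_add_mk, localizedSign_mk]
      intro h h'
      rw [← sign_positiveScalars_smul hσ s', sign_nonneg_iff] at h
      rw [← sign_positiveScalars_smul hσ s, sign_nonneg_iff] at h'
      exact sign_nonneg_iff.2 (add_nonneg h h')
  eq_zero_of_mem_of_neg_mem' {a} := by
    induction a using LocalizedModule.induction_on with
    | h m s =>
      simp only [Set.mem_ofPred_eq, ← LocalizedModule.mk_neg, localizedSign_mk, sign_nonneg_iff]
      intro h h'
      rw [le_antisymm (neg_nonneg.1 h') h, LocalizedModule.zero_mk]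

theorem mk_mem_localizedCone (hσ : ActsWithSign σ V) (m : V) (s : positiveScalars hσ) :
    LocalizedModule.mk m s ∈ localizedCone hσ ↔ 0 ≤ m := by
  change 0 ≤ localizedSign hσ _ ↔ _
  rw [localizedSign_mk, sign_nonneg_iff]

/-- An ordered module on which every scalar has a sign embeds into a divisible one. -/
theorem exists_signDivisible_extension.{u, v} {A : Type u} [CommRing A] {σ : A → SignType}
    {V : Type v} [AddCommGroup V] [LinearOrder V] [IsOrderedAddMonoid V] [Module A V] [Nontrivial V]
    (hσ : ActsWithSign σ V) :
    ∃ (W : Type max u v) (_ : AddCommGroup W) (_ : LinearOrder W) (_ : IsOrderedAddMonoid W)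
      (_ : Module A W) (f : V →ₗ[A] W), StrictMono f ∧ ActsWithSign σ W ∧ IsSignDivisible σ W := by
  classical
  let S := positiveScalars hσ
  have hmem : HasMemOrNegMem (localizedCone hσ) := ⟨fun a => by
    induction a using LocalizedModule.induction_on with
    | h m s =>
      rw [← LocalizedModule.mk_neg, mk_mem_localizedCone, mk_mem_localizedCone, neg_nonneg]
      exact le_total 0 m⟩
  let _ : LinearOrder (LocalizedModule S V) := LinearOrder.mkOfAddGroupCone (localizedCone hσ)
  have : IsOrderedAddMonoid (LocalizedModule S V) := IsOrderedAddMonoid.mkOfCone (localizedCone hσ)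
  have hle : ∀ m s, (0 : LocalizedModule S V) ≤ LocalizedModule.mk m s ↔ 0 ≤ m := fun m s => by
    change _ - _ ∈ localizedCone hσ ↔ _
    rw [sub_zero, mk_mem_localizedCone]
  have hpos : ∀ m s, (0 : LocalizedModule S V) < LocalizedModule.mk m s ↔ 0 < m := fun m s => by
    have h := hle (-m) s
    rw [LocalizedModule.mk_neg, neg_nonneg, neg_nonneg] at h
    rw [← not_le, h, not_le]
  have hsign : ∀ m s, sign (LocalizedModule.mk m s : LocalizedModule S V) = sign m := fun m s => by
    have h := hpos (-m) s
    rw [LocalizedModule.mk_neg, neg_pos, neg_pos] at h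
    simp only [sign_apply, hpos, h]
  refine ⟨LocalizedModule S V, inferInstance, inferInstance, inferInstance, inferInstance,
    LocalizedModule.mkLinearMap S V, ?_, ?_, ?_⟩
  · intro a b hab
    rw [← sub_pos, ← map_sub, LocalizedModule.mkLinearMap_apply, hpos]
    exact sub_pos.2 hab
  · intro p z
    induction z using LocalizedModule.induction_on with
    | h m s => rw [LocalizedModule.smul'_mk, hsign, hsign, hσ]
  -- A positive scalar is an allowed denominator: `m / s = p • (m / (p * s))`. A negative `p` is
  -- handled through `-p`.
  · have key : ∀ p : A, σ p = 1 → ∀ z : LocalizedModule S V, ∃ y, p • y = z := by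
      intro p hp z
      induction z using LocalizedModule.induction_on with
      | h m s =>
        refine ⟨LocalizedModule.mk m (⟨p, hp⟩ * s), ?_⟩
        rw [LocalizedModule.smul'_mk]
        exact LocalizedModule.mk_cancel_common_left (⟨p, hp⟩ : S) s m
    intro p hp z
    rcases (σ p).trichotomy with h | h | h
    · obtain ⟨y, hy⟩ := key (-p) (by rw [hσ.map_neg, h, neg_neg]) z
      exact ⟨-y, by simpa using hy⟩
    · exact absurd h hp
    · exact key p h z

end Localization

/-! ### Ordered `ℤ[X]`-modules as structures -/

/-- The `lang`-structure on `M` is the one given by an ordered `ℤ[X]`-module structure, where `X`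
acts as `ρ`. -/
structure Interprets (M : Type*) [lang.Structure M] [AddCommGroup M] [LinearOrder M]
    [Module ℤ[X] M] : Prop where
  zero : ∀ v : Fin 0 → M, Structure.funMap (L := lang) Func.zero v = 0
  neg : ∀ v : Fin 1 → M, Structure.funMap (L := lang) Func.neg v = -v 0
  rho : ∀ v : Fin 1 → M, Structure.funMap (L := lang) Func.rho v = (X : ℤ[X]) • v 0
  rhoInv : ∀ v : Fin 1 → M, (X : ℤ[X]) • Structure.funMap (L := lang) Func.rhoInv v = v 0
  add : ∀ v : Fin 2 → M, Structure.funMap (L := lang) Func.add v = v 0 + v 1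
  lt : ∀ v : Fin 2 → M, Structure.RelMap (L := lang) Rel.lt v ↔ v 0 < v 1

section Realize

variable {α : Type} {M : Type*} [lang.Structure M]

theorem realize_zeroT (v : α → M) :
    (zeroT : lang.Term α).realize v = Structure.funMap (L := lang) Func.zero ![] := by
  refine congrArg (Structure.funMap (L := lang) Func.zero) ?_
  exact Subsingleton.elim (α := Fin 0 → M) _ _

theorem realize_negT (t : lang.Term α) (v : α → M) :
    (negT t).realize v = Structure.funMap (L := lang) Func.neg ![t.realize v] :=
  Term.realize_functions_apply₁

theorem realize_rhoT (t : lang.Term α) (v : α → M) :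
    (rhoT t).realize v = Structure.funMap (L := lang) Func.rho ![t.realize v] :=
  Term.realize_functions_apply₁

theorem realize_rhoInvT (t : lang.Term α) (v : α → M) :
    (rhoInvT t).realize v = Structure.funMap (L := lang) Func.rhoInv ![t.realize v] :=
  Term.realize_functions_apply₁

theorem realize_addT (s t : lang.Term α) (v : α → M) :
    (addT s t).realize v =
      Structure.funMap (L := lang) Func.add ![s.realize v, t.realize v] :=
  Term.realize_functions_apply₂

theorem realize_ltF {n : ℕ} (s t : lang.Term (α ⊕ Fin n)) (v : α → M) (xs : Fin n → M) :
    (ltF s t).Realize v xs ↔ Structure.RelMap (L := lang) Rel.lt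
      ![s.realize (Sum.elim v xs), t.realize (Sum.elim v xs)] :=
  BoundedFormula.realize_rel₂

end Realize

namespace Interprets

variable {α : Type} {M : Type*} [lang.Structure M] [AddCommGroup M] [LinearOrder M] [Module ℤ[X] M]
  (h : Interprets M)
include h

theorem realize_zeroT (v : α → M) : (zeroT : lang.Term α).realize v = 0 := by
  rw [OrderedDifferenceGroup.realize_zeroT, h.zero]

theorem realize_negT (t : lang.Term α) (v : α → M) : (negT t).realize v = -t.realize v := by
  rw [OrderedDifferenceGroup.realize_negT, h.neg]; rfl

theorem realize_rhoT (t : lang.Term α) (v : α → M) :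
    (rhoT t).realize v = (X : ℤ[X]) • t.realize v := by
  rw [OrderedDifferenceGroup.realize_rhoT, h.rho]; rfl

theorem smul_realize_rhoInvT (t : lang.Term α) (v : α → M) :
    (X : ℤ[X]) • (rhoInvT t).realize v = t.realize v := by
  rw [OrderedDifferenceGroup.realize_rhoInvT, h.rhoInv]; rfl

theorem realize_addT (s t : lang.Term α) (v : α → M) :
    (addT s t).realize v = s.realize v + t.realize v := by
  rw [OrderedDifferenceGroup.realize_addT, h.add]; rfl

theorem realize_ltF {n : ℕ} (s t : lang.Term (α ⊕ Fin n)) (v : α → M) (xs : Fin n → M) :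
    (ltF s t).Realize v xs ↔ s.realize (Sum.elim v xs) < t.realize (Sum.elim v xs) := by
  rw [OrderedDifferenceGroup.realize_ltF, h.lt]; rfl

theorem realize_natMulT (m : ℕ) (t : lang.Term α) (v : α → M) :
    (natMulT m t).realize v = m • t.realize v := by
  induction m with
  | zero => rw [natMulT, h.realize_zeroT, zero_smul]
  | succ m ih => rw [natMulT, h.realize_addT, ih, succ_nsmul]

theorem realize_intMulT (m : ℤ) (t : lang.Term α) (v : α → M) :
    (intMulT m t).realize v = m • t.realize v := by
  cases m with
  | ofNat m => rw [intMulT, h.realize_natMulT, Int.ofNat_eq_natCast, natCast_zsmul]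
  | negSucc m => rw [intMulT, h.realize_negT, h.realize_natMulT, negSucc_zsmul]

theorem realize_rhoPowT (i : ℕ) (t : lang.Term α) (v : α → M) :
    (rhoPowT i t).realize v = (X ^ i : ℤ[X]) • t.realize v := by
  induction i with
  | zero => rw [rhoPowT, pow_zero, one_smul]
  | succ i ih => rw [rhoPowT, h.realize_rhoT, ih, pow_succ', mul_smul]

theorem realize_partialOpT (p : ℤ[X]) (t : lang.Term α) (v : α → M) (k : ℕ) :
    (partialOpT p t k).realize v = ∑ i ∈ Finset.range k, (C (p.coeff i) * X ^ i) • t.realize v := by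
  induction k with
  | zero => rw [partialOpT, h.realize_zeroT, Finset.sum_range_zero]
  | succ k ih =>
    rw [partialOpT, h.realize_addT, ih, Finset.sum_range_succ, h.realize_intMulT,
      h.realize_rhoPowT, mul_smul, eq_intCast C, Int.cast_smul_eq_zsmul]

theorem realize_opT (p : ℤ[X]) (t : lang.Term α) (v : α → M) :
    (opT p t).realize v = p • t.realize v := by
  rw [opT, h.realize_partialOpT, ← Finset.sum_smul, ← p.as_sum_range_C_mul_X_pow]

theorem realize_axiomOM [IsOrderedAddMonoid M] (p : ℤ[X]) :
    M ⊨ axiomOM p ↔ ∃ s : SignType, ∀ x : M, sign (p • x) = s * sign x := by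
  have key : M ⊨ axiomOM p ↔ ((∀ x : M, 0 < x → 0 < p • x) ∨ (∀ x : M, 0 < x → p • x = 0)) ∨
      (∀ x : M, 0 < x → p • x < 0) := by
    simp [axiomOM, Sentence.Realize, Formula.Realize, h.realize_ltF, h.realize_zeroT, h.realize_opT,
      Fin.snoc]
  have hs : ∀ s : SignType, (∀ x : M, 0 < x → sign (p • x) = s) →
      ∀ x : M, sign (p • x) = s * sign x := by
    intro s hs x
    rcases lt_trichotomy 0 x with hx | rfl | hx
    · rw [hs x hx, sign_pos hx, mul_one]
    · rw [smul_zero, sign_zero, mul_zero]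
    · have := hs (-x) (neg_pos.2 hx)
      rw [smul_neg, Left.sign_neg] at this
      rw [sign_neg hx, mul_neg, mul_one, ← this, neg_neg]
  rw [key]
  constructor
  · rintro ((h1 | h1) | h1)
    · exact ⟨1, hs 1 fun x hx => sign_pos (h1 x hx)⟩
    · exact ⟨0, hs 0 fun x hx => by rw [h1 x hx, sign_zero]⟩
    · exact ⟨-1, hs (-1) fun x hx => sign_neg (h1 x hx)⟩
  · rintro ⟨s, hs⟩
    rcases s.trichotomy with rfl | rfl | rfl
    · exact Or.inr fun x hx => sign_eq_neg_one_iff.1 (by rw [hs, sign_pos hx, mul_one])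
    · exact Or.inl (Or.inr fun x hx => sign_eq_zero_iff.1 (by rw [hs, zero_mul]))
    · exact Or.inl (Or.inl fun x hx => sign_eq_one_iff.1 (by rw [hs, sign_pos hx, mul_one]))

theorem realize_nontrivialAxiom : M ⊨ nontrivialAxiom ↔ ∃ x : M, x ≠ 0 := by
  simp [nontrivialAxiom, Sentence.Realize, Formula.Realize, h.realize_zeroT, Fin.snoc]

theorem realize_divisibilityAxiom (p : ℤ[X]) : M ⊨ divisibilityAxiom p ↔
    (∀ x : M, p • x = 0) ∨ Function.Surjective fun x : M => p • x := by
  simp [divisibilityAxiom, Sentence.Realize, Formula.Realize, h.realize_zeroT, h.realize_opT,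
    Fin.snoc, Function.Surjective]

/-- The action of `X` is strictly monotone, hence injective and order-reflecting; each axiom on
`ρ⁻¹` follows by applying `X` and cancelling. -/
theorem models_orderedDifferenceAbelianGroups [IsOrderedAddMonoid M]
    (hX : ∀ x : M, 0 < x → 0 < (X : ℤ[X]) • x) : M ⊨ orderedDifferenceAbelianGroups := by
  have hmono : StrictMono fun x : M => (X : ℤ[X]) • x := fun x y hxy => by
    have := hX _ (sub_pos.2 hxy)
    rwa [smul_sub, sub_pos] at this
  refine ⟨fun φ hφ => ?_⟩
  simp only [orderedDifferenceAbelianGroups, abelianGroupAxioms, linearOrderAxioms,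
    orderCompatibilityAxioms, automorphismAxioms, Set.mem_union, Set.mem_insert_iff,
    Set.mem_singleton_iff] at hφ
  rcases hφ with (((rfl | rfl | rfl | rfl) | (rfl | rfl | rfl)) | (rfl | rfl | rfl)) |
    (rfl | rfl | rfl | rfl) <;>
  simp only [Sentence.Realize, Formula.Realize, BoundedFormula.realize_all,
    BoundedFormula.realize_imp, BoundedFormula.realize_not, BoundedFormula.realize_sup,
    BoundedFormula.realize_bdEqual, h.realize_ltF, h.realize_zeroT, h.realize_addT, h.realize_negT,
    h.realize_rhoT]
  · exact fun a b c => add_assoc a b c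
  · exact fun a b => add_comm a b
  · exact fun a => add_zero a
  · exact fun a => add_neg_cancel a
  · exact fun a => lt_irrefl a
  · exact fun a b c hab hbc => lt_trans hab hbc
  · exact fun a b => or_assoc.2 (lt_trichotomy a b)
  · exact fun a b c hab => add_lt_add_left hab c
  · exact fun a b hab => hmono hab
  · refine fun a b hab => hmono.lt_iff_lt.1 ?_
    simp only [h.smul_realize_rhoInvT]
    exact hab
  · exact fun a b => smul_add _ a b
  · refine fun a b => hmono.injective ?_
    simp only [smul_add, h.smul_realize_rhoInvT, h.realize_addT]
  · refine fun a => ?_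
    simp only [h.smul_realize_rhoInvT]
  · refine fun a => hmono.injective ?_
    simp only [h.smul_realize_rhoInvT, h.realize_rhoT]

end Interprets

/-- An additive endomorphism `ρ` is the same as a `ℤ[X]`-action, by evaluating polynomials at `ρ`.
-/
theorem exists_interprets (M : Type*) [lang.Structure M] [hM : M ⊨ orderedDifferenceAbelianGroups] :
    ∃ (_ : AddCommGroup M) (_ : LinearOrder M) (_ : IsOrderedAddMonoid M) (_ : Module ℤ[X] M),
      Interprets M ∧ ∀ x : M, 0 < x → 0 < (X : ℤ[X]) • x := by
  classical
  have hax := hM.realize_of_mem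
  simp only [orderedDifferenceAbelianGroups, abelianGroupAxioms, linearOrderAxioms,
    orderCompatibilityAxioms, automorphismAxioms, Set.mem_union, Set.mem_insert_iff,
    Set.mem_singleton_iff, or_imp, forall_and, forall_eq, Sentence.Realize, Formula.Realize,
    BoundedFormula.realize_all,
    BoundedFormula.realize_imp, BoundedFormula.realize_not, BoundedFormula.realize_sup,
    BoundedFormula.realize_bdEqual, realize_ltF, realize_zeroT, realize_addT, realize_negT,
    realize_rhoT, realize_rhoInvT] at hax
  obtain ⟨⟨⟨⟨add_assoc', add_comm', add_zero', add_neg'⟩, irrefl', trans', tri'⟩,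
    add_lt', rho_lt', rhoInv_lt'⟩, rho_add', rhoInv_add', rho_rhoInv', rhoInv_rho'⟩ := hax
  let add (a b : M) : M := Structure.funMap (L := lang) Func.add ![a, b]
  let neg (a : M) : M := Structure.funMap (L := lang) Func.neg ![a]
  let zero : M := Structure.funMap (L := lang) Func.zero ![]
  let rho (a : M) : M := Structure.funMap (L := lang) Func.rho ![a]
  let rhoInv (a : M) : M := Structure.funMap (L := lang) Func.rhoInv ![a]
  let lt (a b : M) : Prop := Structure.RelMap (L := lang) Rel.lt ![a, b]
  change ∀ a b c : M, add (add a b) c = add a (add b c) at add_assoc'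
  change ∀ a b : M, add a b = add b a at add_comm'
  change ∀ a : M, add a zero = a at add_zero'
  change ∀ a : M, add a (neg a) = zero at add_neg'
  change ∀ a : M, ¬ lt a a at irrefl'
  change ∀ a b c : M, lt a b → lt b c → lt a c at trans'
  change ∀ a b : M, (lt a b ∨ a = b) ∨ lt b a at tri'
  change ∀ a b c : M, lt a b → lt (add a c) (add b c) at add_lt'
  change ∀ a b : M, lt a b → lt (rho a) (rho b) at rho_lt'
  change ∀ a b : M, rho (add a b) = add (rho a) (rho b) at rho_add'
  change ∀ a : M, rho (rhoInv a) = a at rho_rhoInv'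
  let _ : Zero M := ⟨zero⟩
  let _ : Add M := ⟨add⟩
  let _ : Neg M := ⟨neg⟩
  let iG : AddCommGroup M :=
    { add_assoc := add_assoc'
      add_comm := add_comm'
      add_zero := add_zero'
      zero_add := fun a => (add_comm' zero a).trans (add_zero' a)
      neg_add_cancel := fun a => (add_comm' _ a).trans (add_neg' a)
      nsmul := nsmulRec
      zsmul := zsmulRec }
  let iO : LinearOrder M :=
    { le := fun a b => lt a b ∨ a = b
      lt := lt
      le_refl := fun a => Or.inr rfl
      le_trans := by
        rintro a b c (hab | rfl) (hbc | rfl)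
        exacts [Or.inl (trans' _ _ _ hab hbc), Or.inl hab, Or.inl hbc, Or.inr rfl]
      lt_iff_le_not_ge := by
        refine fun a b => ⟨fun hab => ⟨Or.inl hab, ?_⟩, ?_⟩
        · rintro (hba | rfl)
          exacts [irrefl' _ (trans' _ _ _ hab hba), irrefl' _ hab]
        · rintro ⟨hab | rfl, hba⟩
          exacts [hab, absurd (Or.inr rfl) hba]
      le_antisymm := by
        rintro a b (hab | rfl) (hba | hba)
        exacts [absurd (trans' _ _ _ hab hba) (irrefl' _), hba.symm, rfl, rfl]
      le_total := by
        intro a b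
        rcases tri' a b with (hab | hab) | hab
        exacts [Or.inl (Or.inl hab), Or.inl (Or.inr hab), Or.inr (Or.inl hab)]
      toDecidableLE := Classical.decRel _ }
  have add_le : ∀ a b : M, a ≤ b → ∀ c : M, a + c ≤ b + c := by
    rintro a b (hab | rfl) c
    exacts [Or.inl (add_lt' _ _ _ hab), Or.inr rfl]
  have iOG : IsOrderedAddMonoid M := { add_le_add_left := add_le }
  let ρ : Module.End ℤ M := (AddMonoidHom.mk' rho rho_add').toIntLinearMap
  let iM : Module ℤ[X] M := Module.compHom M (aeval ρ : ℤ[X] →ₐ[ℤ] Module.End ℤ M).toRingHom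
  have hX : ∀ x : M, (X : ℤ[X]) • x = rho x := fun x =>
    congrArg (fun g : Module.End ℤ M => g x) (aeval_X ρ)
  have v1 : ∀ v : Fin 1 → M, v = ![v 0] := fun v => by ext i; fin_cases i; rfl
  have v2 : ∀ v : Fin 2 → M, v = ![v 0, v 1] := fun v => by ext i; fin_cases i <;> rfl
  have rho_zero : rho 0 = 0 := map_zero ρ
  refine ⟨iG, iO, iOG, iM, ⟨?_, ?_, ?_, ?_, ?_, ?_⟩, ?_⟩
  · exact fun v => congrArg _ (Subsingleton.elim _ _)
  · intro v
    rw [v1 v]; rfl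
  · intro v
    rw [hX, v1 v]; rfl
  · intro v
    rw [hX, v1 v]
    exact rho_rhoInv' _
  · intro v
    rw [v2 v]; rfl
  · intro v
    rw [v2 v]; rfl
  · intro x hx
    rw [hX]
    have := rho_lt' 0 x hx
    rwa [rho_zero] at this

/-! ### Models of the two theories as signed modules -/

section Models

theorem models_MODAG_of_models_MODDAG (M : Type*) [lang.Structure M] [M ⊨ MODDAG] : M ⊨ MODAG :=
  Theory.Model.mono ‹M ⊨ MODDAG›
    (Set.subset_union_left.trans (Set.subset_union_left (t := Set.range divisibilityAxiom)))

/-- A model of `MODAG` is an ordered `ℤ[X]`-module on which every scalar has a sign. -/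
theorem exists_actsWithSign (M : Type*) [lang.Structure M] [hM : M ⊨ MODAG] :
    ∃ (_ : AddCommGroup M) (_ : LinearOrder M) (_ : IsOrderedAddMonoid M) (_ : Module ℤ[X] M)
      (σ : ℤ[X] → SignType), Interprets M ∧ ActsWithSign σ M ∧
        ∀ x : M, 0 < x → 0 < (X : ℤ[X]) • x := by
  have : M ⊨ orderedDifferenceAbelianGroups := hM.mono Set.subset_union_left
  obtain ⟨iG, iO, iOG, iM, hI, hX⟩ := exists_interprets M
  have hOM : ∀ p : ℤ[X], ∃ s : SignType, ∀ x : M, sign (p • x) = s * sign x := fun p =>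
    (hI.realize_axiomOM p).1 (MODAG.realize_sentence_of_mem (Or.inr ⟨p, rfl⟩))
  choose σ hσ using hOM
  exact ⟨iG, iO, iOG, iM, σ, hI, hσ, hX⟩

theorem Interprets.nontrivial {M : Type*} [lang.Structure M] [AddCommGroup M] [LinearOrder M]
    [Module ℤ[X] M] (hI : Interprets M) [M ⊨ MODDAG] : Nontrivial M := by
  obtain ⟨x, hx⟩ := hI.realize_nontrivialAxiom.1
    (MODDAG.realize_sentence_of_mem (Or.inl (Or.inr rfl)))
  exact ⟨x, 0, hx⟩

theorem Interprets.isSignDivisible {M : Type*} [lang.Structure M] [AddCommGroup M] [LinearOrder M]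
    [IsOrderedAddMonoid M] [Module ℤ[X] M] (hI : Interprets M) [M ⊨ MODDAG] {σ : ℤ[X] → SignType}
    (hσ : ActsWithSign σ M) : IsSignDivisible σ M := by
  intro p hp
  have := hI.nontrivial
  obtain ⟨x, hx⟩ := exists_pos_of_nontrivial M
  refine ((hI.realize_divisibilityAxiom p).1
    (MODDAG.realize_sentence_of_mem (Or.inr ⟨p, rfl⟩))).resolve_left fun h => hp ?_
  rw [hσ.eq_sign_smul hx, h, sign_zero]

/-- The `lang`-structure on an ordered `ℤ[X]`-module with a given interpretation of `ρ⁻¹`. -/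
@[reducible]
noncomputable def structureOfModule (V : Type*) [AddCommGroup V] [LinearOrder V] [Module ℤ[X] V]
    (rhoInv : V → V) : lang.Structure V where
  funMap {_} f := match f with
    | Func.zero => fun _ => 0
    | Func.neg => fun v => -v 0
    | Func.rho => fun v => (X : ℤ[X]) • v 0
    | Func.rhoInv => fun v => rhoInv (v 0)
    | Func.add => fun v => v 0 + v 1
  RelMap {_} r := match r with
    | Rel.lt => fun v => v 0 < v 1

/-- A nontrivial divisible ordered `ℤ[X]`-module on which every scalar has a sign is a model of
`MODDAG`. -/
theorem exists_models_MODDAG (V : Type*) [AddCommGroup V] [LinearOrder V] [IsOrderedAddMonoid V]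
    [Module ℤ[X] V] [Nontrivial V] {σ : ℤ[X] → SignType} (hσ : ActsWithSign σ V)
    (hd : IsSignDivisible σ V) (hX : σ X = 1) :
    ∃ _ : lang.Structure V, Interprets V ∧ V ⊨ MODDAG := by
  have hsurj : Function.Surjective fun x : V => (X : ℤ[X]) • x := hd X (by rw [hX]; decide)
  -- A right inverse of `X` suffices for `ρ⁻¹`, since `X` has sign 1 and so acts injectively.
  let _ : lang.Structure V := structureOfModule V (Function.surjInv hsurj)
  have hI : Interprets V :=
    { zero := fun _ => rfl
      neg := fun _ => rfl
      rho := fun _ => rfl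
      rhoInv := fun v => Function.surjInv_eq hsurj (v 0)
      add := fun _ => rfl
      lt := fun _ => Iff.rfl }
  refine ⟨_, hI, ⟨?_⟩⟩
  rintro φ (((hφ | ⟨p, rfl⟩) | rfl) | ⟨p, rfl⟩)
  · exact (hI.models_orderedDifferenceAbelianGroups fun x hx => sign_eq_one_iff.1 (by
      rw [hσ, hX, one_mul, sign_pos hx])).realize_of_mem φ hφ
  · exact (hI.realize_axiomOM p).2 ⟨σ p, hσ p⟩
  · exact hI.realize_nontrivialAxiom.2 (exists_ne 0)
  · rw [hI.realize_divisibilityAxiom]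
    by_cases hp : σ p = 0
    · exact Or.inl fun x => sign_eq_zero_iff.1 (by rw [hσ, hp, zero_mul])
    · exact Or.inr (hd p hp)

theorem nonempty_embedding {M N : Type*} [lang.Structure M] [lang.Structure N]
    [AddCommGroup M] [LinearOrder M] [Module ℤ[X] M] [AddCommGroup N] [LinearOrder N]
    [IsOrderedAddMonoid N] [Module ℤ[X] N] (hM : Interprets M) (hN : Interprets N)
    {σ : ℤ[X] → SignType} (hσ : ActsWithSign σ N) (hX : σ X = 1)
    (f : M →ₗ[ℤ[X]] N) (hf : StrictMono f) : Nonempty (M ↪[lang] N) := by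
  have hinj : ∀ x y : N, (X : ℤ[X]) • x = (X : ℤ[X]) • y → x = y := by
    intro x y hxy
    have := hσ X (x - y)
    rwa [smul_sub, hxy, sub_self, sign_zero, hX, one_mul, eq_comm, sign_eq_zero_iff,
      sub_eq_zero] at this
  refine ⟨⟨⟨f, hf.injective⟩, ?_, ?_⟩⟩
  · intro n g x
    change Func n at g
    change f _ = _
    cases g with
    | zero => rw [hM.zero, hN.zero, map_zero]
    | neg => rw [hM.neg, hN.neg, map_neg]; rfl
    | rho => rw [hM.rho, hN.rho, map_smul]; rfl
    | rhoInv => exact hinj _ _ (by rw [← map_smul, hM.rhoInv, hN.rhoInv]; rfl)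
    | add => rw [hM.add, hN.add, map_add]; rfl
  · intro n r x
    change Rel n at r
    cases r with
    | lt =>
      rw [hM.lt, hN.lt]
      exact hf.lt_iff_lt

end Models

/-! ### Mutual embeddability -/

section Embedding

/-- There is a nontrivial divisible ordered `ℤ[X]`-module on which `X` acts as the identity. -/
theorem exists_signDivisible :
    ∃ (W : Type w) (_ : AddCommGroup W) (_ : LinearOrder W) (_ : IsOrderedAddMonoid W)
      (_ : Module ℤ[X] W) (_ : Nontrivial W) (σ : ℤ[X] → SignType),
      σ X = 1 ∧ ActsWithSign σ W ∧ IsSignDivisible σ W := by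
  -- With `ρ = 1`, `p` acts on `ℚ` as multiplication by `p(1)`.
  let iM : Module ℤ[X] (ULift.{w} ℚ) := Module.compHom _ (evalRingHom (1 : ℤ))
  have hsmul : ∀ (p : ℤ[X]) (x : ULift.{w} ℚ), p • x = ⟨(p.eval 1 : ℤ) * x.down⟩ := fun p x => by
    change (p.eval 1 : ℤ) • x = _
    exact ULift.ext _ _ (zsmul_eq_mul _ _)
  have hsign : ∀ x : ULift.{w} ℚ, sign x = sign x.down := fun x => rfl
  refine ⟨ULift.{w} ℚ, inferInstance, inferInstance, ?_, iM, inferInstance,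
    fun p => sign (p.eval 1), ?_, ?_, ?_⟩
  · exact { add_le_add_left := fun a b hab c => add_le_add_left (α := ℚ) hab c.down }
  · simp only [eval_X, sign_one]
  · intro p x
    rw [hsmul, hsign, hsign, sign_mul]
    simp [sign_apply]
  · intro p hp x
    have hp' : ((p.eval 1 : ℤ) : ℚ) ≠ 0 := Int.cast_ne_zero.2 (sign_ne_zero.1 hp)
    refine ⟨⟨x.down / (p.eval 1 : ℤ)⟩, ?_⟩
    change p • _ = x
    rw [hsmul]
    exact ULift.ext _ _ (mul_div_cancel₀ _ hp')

theorem modelsEmbedInto_MODDAG : Theory.ModelsEmbedInto.{0, 0, w} MODAG MODDAG := by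
  intro M _ _ _
  obtain ⟨iG, iO, iOG, iM, σ, hI, hσ, hX⟩ := exists_actsWithSign M
  -- On the trivial group `σ` is arbitrary, so `σ X = 1` may fail and localization is unavailable.
  rcases subsingleton_or_nontrivial M with hM | hM
  · obtain ⟨W, _, _, _, _, _, τ, hτX, hτ, hd⟩ := exists_signDivisible.{w}
    obtain ⟨_, hIW, hW⟩ := exists_models_MODDAG W hτ hd hτX
    exact ⟨W, _, inferInstance, hW, nonempty_embedding hI hIW hτ hτX 0
      (Subsingleton.strictMono _)⟩
  · have hσX : σ X = 1 := by
      obtain ⟨x, hx⟩ := exists_pos_of_nontrivial M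
      rw [hσ.eq_sign_smul hx, sign_pos (hX x hx)]
    obtain ⟨W, _, _, _, _, f, hf, hτ, hd⟩ := exists_signDivisible_extension hσ
    have : Nontrivial W := hf.injective.nontrivial
    obtain ⟨_, hIW, hW⟩ := exists_models_MODDAG W hτ hd hσX
    exact ⟨W, _, inferInstance, hW, nonempty_embedding hI hIW hτ hσX f hf⟩

theorem modelsEmbedInto_MODAG : Theory.ModelsEmbedInto.{0, 0, w} MODDAG MODAG :=
  fun M _ _ _ => ⟨M, _, inferInstance, models_MODAG_of_models_MODDAG M, ⟨Embedding.refl lang M⟩⟩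

end Embedding

/-! ### Quantifier elimination and model completeness -/

section ModelCompleteness

/-- Up to a power of `ρ`, every term is a linear form with coefficients in `ℤ[X]`. -/
theorem exists_linearForm_of_term {β : Type} [Fintype β] (t : lang.Term β) :
    ∃ (k : ℕ) (c : β → ℤ[X]), ∀ (M : Type w) [lang.Structure M] [AddCommGroup M] [LinearOrder M]
      [Module ℤ[X] M], Interprets M → ∀ v : β → M,
        (X ^ k : ℤ[X]) • t.realize v = ∑ i, c i • v i := by
  classical
  induction t with
  | var i =>
    refine ⟨0, Pi.single i 1, fun M _ _ _ _ _ v => ?_⟩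
    rw [pow_zero, one_smul, Term.realize_var, Finset.sum_eq_single i]
    · rw [Pi.single_eq_same, one_smul]
    · intro j _ hj
      rw [Pi.single_eq_of_ne hj, zero_smul]
    · simp
  | @func l f ts ih =>
    change Func l at f
    cases f with
    | zero =>
      refine ⟨0, 0, fun M _ _ _ _ hI v => ?_⟩
      refine (congrArg _ (hI.zero fun i => (ts i).realize v)).trans ?_
      simp
    | neg =>
      obtain ⟨k, c, hc⟩ := ih 0
      refine ⟨k, -c, fun M _ _ _ _ hI v => ?_⟩
      refine (congrArg _ (hI.neg fun i => (ts i).realize v)).trans ?_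
      rw [smul_neg, hc M hI]
      simp
    | rho =>
      obtain ⟨k, c, hc⟩ := ih 0
      refine ⟨k, (X : ℤ[X]) • c, fun M _ _ _ _ hI v => ?_⟩
      refine (congrArg _ (hI.rho fun i => (ts i).realize v)).trans ?_
      rw [smul_comm, hc M hI, Finset.smul_sum]
      simp [mul_smul]
    | rhoInv =>
      obtain ⟨k, c, hc⟩ := ih 0
      refine ⟨k + 1, c, fun M _ _ _ _ hI v => ?_⟩
      -- One more factor `X` absorbs the outer `ρ⁻¹`.
      rw [pow_succ, mul_smul, ← hc M hI]
      exact congrArg _ (hI.rhoInv fun i => (ts i).realize v)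
    | add =>
      obtain ⟨k, c, hc⟩ := ih 0
      obtain ⟨l, d, hd⟩ := ih 1
      refine ⟨k + l, (X ^ l : ℤ[X]) • c + (X ^ k : ℤ[X]) • d, fun M _ _ _ _ hI v => ?_⟩
      refine (congrArg _ (hI.add fun i => (ts i).realize v)).trans ?_
      rw [smul_add, pow_add, mul_smul, mul_smul, hd M hI,
        smul_comm, hc M hI, Finset.smul_sum, Finset.smul_sum, ← Finset.sum_add_distrib]
      simp [mul_smul, add_smul]

/-- The sign of a difference of terms is the sign of a linear form. -/
theorem exists_linearForm_sign_sub {β : Type} [Fintype β] (s t : lang.Term β) :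
    ∃ c : β → ℤ[X], ∀ (M : Type w) [lang.Structure M] [AddCommGroup M] [LinearOrder M]
      [IsOrderedAddMonoid M] [Module ℤ[X] M], Interprets M →
      (∀ x : M, 0 < x → 0 < (X : ℤ[X]) • x) → ∀ v : β → M,
        sign (s.realize v - t.realize v) = sign (∑ i, c i • v i) := by
  obtain ⟨k, c, hc⟩ := exists_linearForm_of_term.{w} s
  obtain ⟨l, d, hd⟩ := exists_linearForm_of_term.{w} t
  refine ⟨(X ^ l : ℤ[X]) • c - (X ^ k : ℤ[X]) • d, fun M _ _ _ _ _ hI hX v => ?_⟩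
  have hpow : ∀ (j : ℕ) (x : M), sign ((X ^ j : ℤ[X]) • x) = sign x := by
    intro j x
    have hpos : ∀ y : M, 0 < y → 0 < (X ^ j : ℤ[X]) • y := by
      intro y hy
      induction j with
      | zero => simpa using hy
      | succ j ih =>
        rw [pow_succ', mul_smul]
        exact hX _ ih
    rcases lt_trichotomy 0 x with hx | rfl | hx
    · rw [sign_pos hx, sign_pos (hpos x hx)]
    · rw [smul_zero]
    · have := hpos (-x) (neg_pos.2 hx)
      rw [smul_neg, neg_pos] at this
      rw [sign_neg hx, sign_neg this]
  -- Powers of `X` preserve signs, so both terms can be cleared of `ρ⁻¹` at once.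
  rw [← hpow (k + l)]
  congr 1
  rw [smul_sub, pow_add, mul_smul (X ^ k : ℤ[X]) _ (t.realize v), hd M hI, mul_comm, mul_smul,
    hc M hI, Finset.smul_sum, Finset.smul_sum, ← Finset.sum_sub_distrib]
  simp [mul_smul, sub_smul]

/-- A linear form in the variables `α ⊕ Fin (n + 1)`, with the coefficient of the last variable
split off. -/
def splitLast {A α : Type*} {n : ℕ} (c : α ⊕ Fin (n + 1) → A) : (α ⊕ Fin n → A) × A :=
  (Sum.elim (fun i => c (Sum.inl i)) fun i => c (Sum.inr i.castSucc), c (Sum.inr (Fin.last n)))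

theorem sum_smul_snoc {A α V : Type*} [Ring A] [Fintype α] [AddCommGroup V] [Module A V] {n : ℕ}
    (c : α ⊕ Fin (n + 1) → A) (v : α → V) (xs : Fin n → V) (a : V) :
    ∑ i, c i • (Sum.elim v (Fin.snoc xs a : Fin (n + 1) → V)) i =
      ∑ i, (splitLast c).1 i • (Sum.elim v xs) i + (splitLast c).2 • a := by
  simp [Fintype.sum_sum_type, Fin.sum_univ_castSucc, splitLast, add_assoc]

theorem SameSigns.symm {A ι V W : Type*} [CommRing A] [Fintype ι] [AddCommGroup V] [LinearOrder V]
    [Module A V] [AddCommGroup W] [LinearOrder W] [Module A W] {S : Set (ι → A)} {x : ι → V}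
    {y : ι → W} (h : SameSigns S x y) : SameSigns S y x :=
  fun c hc => (h c hc).symm

theorem exists_snoc_sameSigns {A α V W : Type*} [CommRing A] [Fintype α] {σ : A → SignType}
    [AddCommGroup V] [LinearOrder V] [IsOrderedAddMonoid V] [Module A V]
    [AddCommGroup W] [LinearOrder W] [IsOrderedAddMonoid W] [Module A W] [Nontrivial W]
    (hV : ActsWithSign σ V) (hW : ActsWithSign σ W)
    (hdV : IsSignDivisible σ V) (hdW : IsSignDivisible σ W)
    {n : ℕ} {S : Set (α ⊕ Fin (n + 1) → A)} (hS : S.Finite) {v : α → V} {xs : Fin n → V}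
    {v' : α → W} {xs' : Fin n → W}
    (h : SameSigns (eliminate (splitLast '' S)) (Sum.elim v xs) (Sum.elim v' xs')) (a : V) :
    ∃ b : W, SameSigns S (Sum.elim v (Fin.snoc xs a : Fin (n + 1) → V))
      (Sum.elim v' (Fin.snoc xs' b : Fin (n + 1) → W)) := by
  obtain ⟨b, hb⟩ := exists_extend_sameSigns hV hW hdV hdW (hS.image splitLast) h a
  refine ⟨b, fun c hc => ?_⟩
  rw [sum_smul_snoc, sum_smul_snoc]
  exact hb _ ⟨c, hc, rfl⟩

/-- The truth of a formula depends only on the signs of finitely many linear forms. -/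
theorem exists_finite_sameSigns {α : Type} [Fintype α] {M N : Type w}
    [lang.Structure M] [AddCommGroup M] [LinearOrder M] [IsOrderedAddMonoid M] [Module ℤ[X] M]
    [Nontrivial M]
    [lang.Structure N] [AddCommGroup N] [LinearOrder N] [IsOrderedAddMonoid N] [Module ℤ[X] N]
    [Nontrivial N]
    (hM : Interprets M) (hN : Interprets N)
    (hXM : ∀ x : M, 0 < x → 0 < (X : ℤ[X]) • x) (hXN : ∀ x : N, 0 < x → 0 < (X : ℤ[X]) • x)
    {σ : ℤ[X] → SignType} (hσM : ActsWithSign σ M) (hσN : ActsWithSign σ N)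
    (hdM : IsSignDivisible σ M) (hdN : IsSignDivisible σ N)
    {n : ℕ} (φ : lang.BoundedFormula α n) :
    ∃ S : Set (α ⊕ Fin n → ℤ[X]), S.Finite ∧ ∀ (v : α → M) (xs : Fin n → M) (v' : α → N)
      (xs' : Fin n → N), SameSigns S (Sum.elim v xs) (Sum.elim v' xs') →
        (φ.Realize v xs ↔ φ.Realize v' xs') := by
  induction φ with
  | falsum => exact ⟨∅, Set.finite_empty, fun _ _ _ _ _ => Iff.rfl⟩
  | equal s t =>
    obtain ⟨c, hc⟩ := exists_linearForm_sign_sub.{w} s t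
    refine ⟨{c}, Set.finite_singleton c, fun v xs v' xs' h => ?_⟩
    have := h c rfl
    rw [← hc M hM hXM, ← hc N hN hXN] at this
    change s.realize _ = t.realize _ ↔ s.realize _ = t.realize _
    rw [← sub_eq_zero, ← sign_eq_zero_iff, this, sign_eq_zero_iff, sub_eq_zero]
  | @rel n l R ts =>
    change Rel l at R
    cases R with
    | lt =>
      obtain ⟨c, hc⟩ := exists_linearForm_sign_sub.{w} (ts 0) (ts 1)
      refine ⟨{c}, Set.finite_singleton c, fun v xs v' xs' h => ?_⟩
      have := h c rfl
      rw [← hc M hM hXM, ← hc N hN hXN] at this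
      refine (hM.lt _).trans (Iff.trans ?_ (hN.lt _).symm)
      rw [← sub_neg, ← sign_eq_neg_one_iff, this, sign_eq_neg_one_iff, sub_neg]
  | imp φ ψ ihφ ihψ =>
    obtain ⟨S, hS, hφ⟩ := ihφ
    obtain ⟨T, hT, hψ⟩ := ihψ
    refine ⟨S ∪ T, hS.union hT, fun v xs v' xs' h => ?_⟩
    rw [BoundedFormula.realize_imp, BoundedFormula.realize_imp,
      hφ v xs v' xs' fun c hc => h c (Or.inl hc), hψ v xs v' xs' fun c hc => h c (Or.inr hc)]
  | all φ ih =>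
    obtain ⟨S, hS, hφ⟩ := ih
    refine ⟨eliminate (splitLast '' S), eliminate_finite (hS.image _), fun v xs v' xs' h => ?_⟩
    rw [BoundedFormula.realize_all, BoundedFormula.realize_all]
    constructor
    · intro H b
      obtain ⟨a, ha⟩ := exists_snoc_sameSigns hσN hσM hdN hdM hS h.symm b
      exact (hφ _ _ _ _ ha.symm).1 (H a)
    · intro H a
      obtain ⟨b, hb⟩ := exists_snoc_sameSigns hσM hσN hdM hdN hS h a
      exact (hφ _ _ _ _ hb).2 (H b)

theorem isModelComplete_MODDAG : Theory.IsModelComplete.{0, 0, w} MODDAG := by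
  intro M N _ _ _ _ _ _ f n φ x
  have := models_MODAG_of_models_MODDAG M
  have := models_MODAG_of_models_MODDAG N
  obtain ⟨_, _, _, _, σ, hM, hσ, hXM⟩ := exists_actsWithSign M
  obtain ⟨_, _, _, _, τ, hN, hτ, hXN⟩ := exists_actsWithSign N
  have := hM.nontrivial
  have := hN.nontrivial
  have hadd : ∀ a b : M, f (a + b) = f a + f b := fun a b => by
    have := f.map_fun (Func.add : lang.Functions 2) ![a, b]
    rw [hM.add, hN.add] at this
    exact this
  let g : M →+ N := AddMonoidHom.mk' f hadd
  have hlt : ∀ a b : M, f a < f b ↔ a < b := fun a b => by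
    have := f.map_rel (Rel.lt : lang.Relations 2) ![a, b]
    rw [hM.lt, hN.lt] at this
    exact this
  have hsmul : ∀ (p : ℤ[X]) (a : M), f (p • a) = p • f a := fun p a => by
    have := HomClass.realize_term f (t := opT p (var () : lang.Term Unit)) (v := fun _ => a)
    rw [hM.realize_opT, hN.realize_opT] at this
    exact this.symm
  have hsign : ∀ a : M, sign (f a) = sign a := fun a => by
    have h0 : f 0 = 0 := map_zero g
    have h1 := hlt 0 a
    have h2 := hlt a 0
    rw [h0] at h1 h2
    simp only [sign_apply, h1, h2]
  -- The sign of `p` can be read off at one positive element of `M`, and `f` preserves it.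
  obtain rfl : σ = τ := by
    obtain ⟨a, ha⟩ := exists_pos_of_nontrivial M
    ext p
    rw [hσ.eq_sign_smul ha, ← hsign, hsmul, hτ, hsign, sign_pos ha, mul_one]
  obtain ⟨S, -, hS⟩ := exists_finite_sameSigns hM hN hXM hXN hσ hτ (hM.isSignDivisible hσ)
    (hN.isSignDivisible hτ) φ
  refine (hS x default (f ∘ x) default fun c _ => ?_).symm
  have hsum : ∑ i, c i • (Sum.elim (f ∘ x) default : Fin n ⊕ Fin 0 → N) i =
      f (∑ i, c i • (Sum.elim x default : Fin n ⊕ Fin 0 → M) i) := by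
    refine Eq.trans ?_ (map_sum g _ _).symm
    refine Finset.sum_congr rfl fun i _ => ?_
    rcases i with i | i
    · exact (hsmul _ _).symm
    · exact i.elim0
  rw [hsum, hsign]

end ModelCompleteness

end OrderedDifferenceGroup

theorem theorem2p6 :
    FirstOrder.Language.Theory.IsModelCompanion.{0, 0, w}
      OrderedDifferenceGroup.MODDAG OrderedDifferenceGroup.MODAG :=
  ⟨OrderedDifferenceGroup.modelsEmbedInto_MODDAG, OrderedDifferenceGroup.modelsEmbedInto_MODAG,
    OrderedDifferenceGroup.isModelComplete_MODDAG⟩
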